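/- Let $\ell>3$ be a prime and let $k\ge 0$ be an even integer. Let $M_k(1)$ and $S_k(1)$ denote the spaces of (entire) modular forms and of cusp forms of weight $k$ for $\mathrm{SL}_2(\mathbb Z)$. For $\tau$ in the upper half plane put $q=e^{2\pi i\tau}$, let $\eta(\tau)=e^{\pi i\tau/12}\prod_{n\ge1}(1-q^n)$ be the Dedekind eta function, and let $$h_\ell(\tau)=\bigl(\eta(\tau)\,\eta(\ell\tau)\bigr)^{\ell-1}.$$ Let $U(\ell)$ be the operator on power series in $q$ given by $\bigl(\sum_{n\ge0}a(n)q^n\bigr)\mid U(\ell)=\sum_{n\ge0}a(\ell n)q^n$. Let $F\in M_k(1)$. Then $h_\ell F$ has a $q$-expansion $h_\ell(\tau)F(\tau)=\sum_{n\ge0}a(n)q^n$ that converges on the upper half plane, the series $(h_\ell F)\mid U(\ell)=\sum_{n\ge0}a(\ell n)q^n$ also converges there, and the function $$\bigl((h_\ell F)\mid U(\ell)\bigr)(\tau)+(-1)^{(\ell-1)/2}\,\ell^{\,k+(\ell-1)/2-1}\,h_\ell(\tau)\,F(\ell\tau)$$ belongs to $S_{k+\ell-1}(1)$. -/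

import Mathlib

open UpperHalfPlane ModularForm
open scoped MatrixGroups

/-- The function `h_ℓ(τ) = (η(τ) η(ℓτ)) ^ (ℓ - 1)` on the upper half plane. -/
noncomputable def hEll (ℓ : ℕ) (τ : ℍ) : ℂ :=
  (ModularForm.eta (τ : ℂ) * ModularForm.eta ((ℓ : ℂ) * (τ : ℂ))) ^ (ℓ - 1)

/-- The point `mτ` of the upper half plane, for a positive integer `m`. -/
def dilate (m : ℕ) (hm : 0 < m) (τ : ℍ) : ℍ :=
  ⟨(m : ℂ) * (τ : ℂ), by
    have h : (0 : ℝ) < m := Nat.cast_pos.mpr hm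
    simpa using mul_pos h τ.im_pos⟩

/-- The operator `U(m)` on formal power series: `(∑ a(n) qⁿ) | U(m) = ∑ a(mn) qⁿ`. -/
noncomputable def powerSeriesU (m : ℕ) (p : PowerSeries ℂ) : PowerSeries ℂ :=
  PowerSeries.mk fun n ↦ p.coeff (m * n)

/-- `p` is the `q`-expansion of `f`: for every `τ` in the upper half plane, the series
`∑ p(n) qⁿ` with `q = exp (2πiτ)` converges, and its sum is `f τ`. -/
def HasQExpansion (f : ℍ → ℂ) (p : PowerSeries ℂ) : Prop :=
  ∀ τ : ℍ, HasSum (fun n : ℕ ↦ p.coeff n * Function.Periodic.qParam 1 (τ : ℂ) ^ n) (f τ)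

open Filter Topology Manifold

/-! The stated combination is, up to a scalar, a trace from `Γ₀(ℓ)` to level one. Put `f(τ) = h_ℓ(τ)
F(ℓτ)` and `ℓ = 2m + 1`. By `hEll_smul`, `f` is invariant of weight `k + ℓ - 1` under `Γ₀(ℓ)`, with
trivial character because `24 ∣ ℓ² - 1`. Its trace is `f + ∑ f ∣ S T ^ j` over `j` mod `ℓ`. By
`hEllMulDilate_slash_S`, `f ∣ S` is `(-1)^m ℓ^(-m-k)` times `h_ℓ F` at `τ / ℓ`, so the sum over `j`
is this constant times `ℓ · (h_ℓ F) ∣ U(ℓ)` (`HasQExpansion.powerSeriesU`). Multiplying the trace by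
`(-1)^m ℓ^(k+m-1)` gives the claim; cuspidality holds because `η` vanishes at `i∞`. -/

/-! ### The multiplier system of `η ^ 2` -/

/-- The square of the Dedekind eta function, as a function on the upper half plane. -/
noncomputable def etaSq (τ : ℍ) : ℂ := ModularForm.eta (τ : ℂ) ^ 2

/-- Dedekind's polynomial in the entries of a matrix of determinant `1`; its value modulo `12` is
the exponent of the multiplier of `η ^ 2`. -/
def etaSqPhase {R : Type*} [CommRing R] (a b c d : R) : R :=
  (1 - c ^ 2) * (b * d + 3 * (c - 1) * d + c + 3) + c * (a + d - 3)

lemma map_etaSqPhase {R S : Type*} [CommRing R] [CommRing S] (f : R →+* S) (a b c d : R) :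
    f (etaSqPhase a b c d) = etaSqPhase (f a) (f b) (f c) (f d) := by
  simp [etaSqPhase, map_ofNat f 3]

/-- Chinese remainder theorem; it keeps the exhaustive checks of the phase identities small. -/
lemma ZMod.eq_of_castHom_three_four {x y : ZMod 12}
    (h₃ : ZMod.castHom (show 3 ∣ 12 by decide) (ZMod 3) x =
      ZMod.castHom (show 3 ∣ 12 by decide) (ZMod 3) y)
    (h₄ : ZMod.castHom (show 4 ∣ 12 by decide) (ZMod 4) x =
      ZMod.castHom (show 4 ∣ 12 by decide) (ZMod 4) y) : x = y := by
  revert x y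
  decide

/-- Matches `η² ∣ T = e^(2πi/12) η²`. Together with the increment `-3` for `S`, this determines the
phase on all of `SL(2, ℤ)`. -/
lemma etaSqPhase_mul_T {a b c d : ZMod 12} (h : a * d - b * c = 1) :
    etaSqPhase a (a + b) c (c + d) = etaSqPhase a b c d + 1 := by
  have h₃ : ∀ a b c d : ZMod 3, a * d - b * c = 1 →
      etaSqPhase a (a + b) c (c + d) = etaSqPhase a b c d + 1 := by
    unfold etaSqPhase; decide +kernel
  have h₄ : ∀ a b c d : ZMod 4, a * d - b * c = 1 →
      etaSqPhase a (a + b) c (c + d) = etaSqPhase a b c d + 1 := by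
    unfold etaSqPhase; decide +kernel
  apply ZMod.eq_of_castHom_three_four
  · let f := ZMod.castHom (show 3 ∣ 12 by decide) (ZMod 3)
    simpa only [f, map_etaSqPhase, map_add, map_sub, map_mul, map_neg, map_one, map_ofNat]
      using h₃ (f a) (f b) (f c) (f d)
      (by rw [← map_mul, ← map_mul, ← map_sub, h, map_one])
  · let f := ZMod.castHom (show 4 ∣ 12 by decide) (ZMod 4)
    simpa only [f, map_etaSqPhase, map_add, map_sub, map_mul, map_neg, map_one, map_ofNat]
      using h₄ (f a) (f b) (f c) (f d)
      (by rw [← map_mul, ← map_mul, ← map_sub, h, map_one])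

lemma etaSqPhase_mul_S {a b c d : ZMod 12} (h : a * d - b * c = 1) :
    etaSqPhase b (-a) d (-c) = etaSqPhase a b c d - 3 := by
  have h₃ : ∀ a b c d : ZMod 3, a * d - b * c = 1 →
      etaSqPhase b (-a) d (-c) = etaSqPhase a b c d - 3 := by
    unfold etaSqPhase; decide +kernel
  have h₄ : ∀ a b c d : ZMod 4, a * d - b * c = 1 →
      etaSqPhase b (-a) d (-c) = etaSqPhase a b c d - 3 := by
    unfold etaSqPhase; decide +kernel
  apply ZMod.eq_of_castHom_three_four
  · let f := ZMod.castHom (show 3 ∣ 12 by decide) (ZMod 3)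
    simpa only [f, map_etaSqPhase, map_add, map_sub, map_mul, map_neg, map_one, map_ofNat]
      using h₃ (f a) (f b) (f c) (f d)
      (by rw [← map_mul, ← map_mul, ← map_sub, h, map_one])
  · let f := ZMod.castHom (show 4 ∣ 12 by decide) (ZMod 4)
    simpa only [f, map_etaSqPhase, map_add, map_sub, map_mul, map_neg, map_one, map_ofNat]
      using h₄ (f a) (f b) (f c) (f d)
      (by rw [← map_mul, ← map_mul, ← map_sub, h, map_one])

/-- Conjugation by `diag(u, 1)` multiplies the phase by `u`, for every unit `u` modulo `12`. -/
lemma etaSqPhase_conj {u a b c d : ZMod 12} (hu : u ^ 2 = 1) (h : a * d - b * (u * c) = 1) :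
    etaSqPhase a (u * b) c d = u * etaSqPhase a b (u * c) d := by
  have h₃ : ∀ u : ZMod 3, u ^ 2 = 1 → ∀ a b c d : ZMod 3, a * d - b * (u * c) = 1 →
      etaSqPhase a (u * b) c d = u * etaSqPhase a b (u * c) d := by
    unfold etaSqPhase; decide +kernel
  have h₄ : ∀ u : ZMod 4, u ^ 2 = 1 → ∀ a b c d : ZMod 4, a * d - b * (u * c) = 1 →
      etaSqPhase a (u * b) c d = u * etaSqPhase a b (u * c) d := by
    unfold etaSqPhase; decide +kernel
  apply ZMod.eq_of_castHom_three_four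
  · let f := ZMod.castHom (show 3 ∣ 12 by decide) (ZMod 3)
    simpa only [f, map_etaSqPhase, map_add, map_sub, map_mul, map_neg, map_one, map_ofNat]
      using h₃ (f u) (by rw [← map_pow, hu, map_one])
      (f a) (f b) (f c) (f d) (by rw [← map_mul, ← map_mul, ← map_mul, ← map_sub, h, map_one])
  · let f := ZMod.castHom (show 4 ∣ 12 by decide) (ZMod 4)
    simpa only [f, map_etaSqPhase, map_add, map_sub, map_mul, map_neg, map_one, map_ofNat]
      using h₄ (f u) (by rw [← map_pow, hu, map_one])
      (f a) (f b) (f c) (f d) (by rw [← map_mul, ← map_mul, ← map_mul, ← map_sub, h, map_one])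

/-- The exponent of the multiplier of `η ^ 2` at an element of `SL(2, ℤ)`. -/
def slPhase (γ : SL(2, ℤ)) : ZMod 12 :=
  etaSqPhase (γ 0 0 : ZMod 12) (γ 0 1 : ZMod 12) (γ 1 0 : ZMod 12) (γ 1 1 : ZMod 12)

lemma det_cast_eq_one (R : Type*) [CommRing R] (γ : SL(2, ℤ)) :
    (γ 0 0 : R) * (γ 1 1 : R) - (γ 0 1 : R) * (γ 1 0 : R) = 1 := by
  have h := γ.det_coe
  rw [Matrix.det_fin_two] at h
  exact_mod_cast congrArg (Int.cast : ℤ → R) h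

lemma slPhase_one : slPhase 1 = 0 := by
  simp [slPhase, etaSqPhase]

lemma slPhase_mul_T (γ : SL(2, ℤ)) : slPhase (γ * ModularGroup.T) = slPhase γ + 1 := by
  rw [slPhase, slPhase, ← etaSqPhase_mul_T (det_cast_eq_one (ZMod 12) γ)]
  simp [Matrix.SpecialLinearGroup.coe_mul, ModularGroup.coe_T, Matrix.mul_apply, Fin.sum_univ_two]

lemma slPhase_mul_S (γ : SL(2, ℤ)) : slPhase (γ * ModularGroup.S) = slPhase γ - 3 := by
  rw [slPhase, slPhase, ← etaSqPhase_mul_S (det_cast_eq_one (ZMod 12) γ)]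
  simp [Matrix.SpecialLinearGroup.coe_mul, ModularGroup.coe_S, Matrix.mul_apply, Fin.sum_univ_two]

lemma etaSq_slash_T :
    etaSq ∣[(1 : ℤ)] ModularGroup.T = (ZMod.stdAddChar (1 : ZMod 12) : ℂ) • etaSq := by
  ext τ
  have hq : ∀ n, ModularForm.eta_q n (1 + (τ : ℂ)) = ModularForm.eta_q n τ := fun n ↦ by
    rw [ModularForm.eta_q, ModularForm.eta_q]
    congr 1
    simp only [Function.Periodic.qParam, Complex.ofReal_one, div_one, mul_add, mul_one,
      Complex.exp_add, Complex.exp_two_pi_mul_I, one_mul]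
  have h1 := ZMod.stdAddChar_coe (N := 12) 1
  rw [Int.cast_one] at h1
  rw [SL_slash_apply, modular_T_smul, h1]
  have hd : denom (ModularGroup.T : GL (Fin 2) ℝ) τ = 1 := by
    rw [ModularGroup.denom_apply]
    simp [ModularGroup.T]
  rw [hd]
  simp only [etaSq, ModularForm.eta, coe_vadd, Complex.ofReal_one, hq, Pi.smul_apply, smul_eq_mul,
    one_zpow, mul_one, mul_pow, ← mul_assoc]
  congr 1
  simp only [Function.Periodic.qParam, ← Complex.exp_nat_mul, ← Complex.exp_add]
  congr 1
  push_cast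
  ring

lemma stdAddChar_neg_three : (ZMod.stdAddChar (-3 : ZMod 12) : ℂ) = -Complex.I := by
  have h := ZMod.stdAddChar_coe (N := 12) (-3)
  push_cast at h
  rw [h, ← Complex.exp_neg_pi_div_two_mul_I]
  congr 1
  ring

/-- Squaring removes the choice of square root in the inversion formula for `η`. -/
lemma etaSq_S_smul (τ : ℍ) : etaSq (ModularGroup.S • τ) = -Complex.I * τ * etaSq τ := by
  have he : ModularForm.eta (-(τ : ℂ))⁻¹ =
      (Complex.sqrt Complex.I)⁻¹ * (Complex.sqrt τ * ModularForm.eta τ) := by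
    simpa [neg_div, inv_neg] using ModularForm.eta_comp_eq_csqrt_I_inv τ.2
  have hs : ∀ z : ℂ, Complex.sqrt z ^ 2 = z := fun z ↦ by
    simp [Complex.sqrt]
  rw [modular_S_smul]
  simp only [etaSq]
  rw [he, mul_pow, inv_pow, mul_pow, hs, hs, Complex.inv_I, mul_assoc]

lemma etaSq_slash_S :
    etaSq ∣[(1 : ℤ)] ModularGroup.S = (ZMod.stdAddChar (-3 : ZMod 12) : ℂ) • etaSq := by
  ext τ
  rw [SL_slash_apply, etaSq_S_smul, ModularGroup.denom_S, stdAddChar_neg_three]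
  have := τ.ne_zero
  simp only [Pi.smul_apply, smul_eq_mul, zpow_neg, zpow_one]
  field_simp

/-- The transformation law of `η ^ 2` under `SL(2, ℤ)`. -/
theorem etaSq_slash (γ : SL(2, ℤ)) :
    etaSq ∣[(1 : ℤ)] γ = (ZMod.stdAddChar (slPhase γ) : ℂ) • etaSq := by
  -- An equivalence, so that inverse generators are covered by applying it to `x * g⁻¹`.
  have mul_gen : ∀ x g : SL(2, ℤ), ∀ t : ZMod 12, slPhase (x * g) = slPhase x + t →
      etaSq ∣[(1 : ℤ)] g = (ZMod.stdAddChar t : ℂ) • etaSq →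
      (etaSq ∣[(1 : ℤ)] x = (ZMod.stdAddChar (slPhase x) : ℂ) • etaSq ↔
        etaSq ∣[(1 : ℤ)] (x * g) = (ZMod.stdAddChar (slPhase (x * g)) : ℂ) • etaSq) := by
    intro x g t hx hg
    have key : (ZMod.stdAddChar (slPhase (x * g)) : ℂ) • etaSq =
        ((ZMod.stdAddChar (slPhase x) : ℂ) • etaSq) ∣[(1 : ℤ)] g := by
      rw [SL_smul_slash, hg, hx, AddChar.map_add_eq_mul, mul_smul]
    rw [key, SlashAction.slash_mul]
    refine ⟨fun h ↦ by rw [h], fun h ↦ ?_⟩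
    simpa [← SlashAction.slash_mul] using congrArg (· ∣[(1 : ℤ)] g⁻¹) h
  have gen : ∀ g ∈ ({ModularGroup.S, ModularGroup.T} : Set SL(2, ℤ)), ∃ t : ZMod 12,
      (∀ x, slPhase (x * g) = slPhase x + t) ∧
      etaSq ∣[(1 : ℤ)] g = (ZMod.stdAddChar t : ℂ) • etaSq := by
    rintro g (rfl | rfl)
    · exact ⟨-3, fun x ↦ by rw [slPhase_mul_S, sub_eq_add_neg], etaSq_slash_S⟩
    · exact ⟨1, slPhase_mul_T, etaSq_slash_T⟩
  have hγ : γ ∈ Subgroup.closure {ModularGroup.S, ModularGroup.T} := by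
    simp [SpecialLinearGroup.SL2Z_generators]
  induction hγ using Subgroup.closure_induction_right with
  | one => simp [slPhase_one]
  | mul_right x _ g hg ih =>
    obtain ⟨t, ht, hgt⟩ := gen g hg
    exact (mul_gen x g t (ht x) hgt).mp ih
  | mul_inv_cancel x _ g hg ih =>
    obtain ⟨t, ht, hgt⟩ := gen g hg
    refine (mul_gen (x * g⁻¹) g t (ht _) hgt).mpr ?_
    simpa using ih

lemma etaSq_smul (γ : SL(2, ℤ)) (τ : ℍ) :
    etaSq (γ • τ) = ZMod.stdAddChar (slPhase γ) * denom γ τ * etaSq τ := by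
  have h := congrFun (etaSq_slash γ) τ
  rw [SL_slash_apply, Pi.smul_apply, smul_eq_mul, zpow_neg, zpow_one] at h
  rw [mul_right_comm, ← h, inv_mul_cancel_right₀ (denom_ne_zero _ τ)]

/-! ### Transformation of `h_ℓ` under `Γ₀(ℓ)` and under inversion -/

lemma hEll_eq_etaSq_pow {ℓ m : ℕ} (hm : ℓ = 2 * m + 1) (hℓ : 0 < ℓ) (τ : ℍ) :
    hEll ℓ τ = (etaSq τ * etaSq (dilate ℓ hℓ τ)) ^ m := by
  rw [hEll, etaSq, etaSq, ← mul_pow, ← pow_mul, show ℓ - 1 = 2 * m by lia]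
  rfl

/-- The product is `(ℓ² - 1) / 2 = 2m(m + 1)`, and `3 ∤ ℓ` excludes `m ≡ 1` mod `3`, so `6 ∣ m(m +
1)`. -/
lemma twelve_dvd_of_prime {ℓ m : ℕ} (hℓ : ℓ.Prime) (hℓ3 : 3 < ℓ) (hm : ℓ = 2 * m + 1) :
    12 ∣ m * (ℓ + 1) := by
  have h3 : ¬ 3 ∣ ℓ := fun h ↦ by
    have := (Nat.prime_dvd_prime_iff_eq Nat.prime_three hℓ).mp h
    lia
  have h2 : m * (ℓ + 1) = 2 * (m * (m + 1)) := by rw [hm]; ring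
  have h : m % 6 = 0 ∨ m % 6 = 2 ∨ m % 6 = 3 ∨ m % 6 = 5 := by lia
  rw [h2, Nat.dvd_iff_mod_eq_zero]
  rcases h with h | h | h | h
  all_goals
    obtain ⟨q, hq⟩ : ∃ q, m = 6 * q + m % 6 := ⟨m / 6, by lia⟩
    rw [h] at hq
    rw [hq]
    ring_nf
    lia

/-- Conjugation of an element of `Γ₀(ℓ)` by `diag(ℓ, 1)`. -/
lemma exists_conj_dilate {ℓ : ℕ} (γ : SL(2, ℤ)) (h : (ℓ : ℤ) ∣ γ 1 0) :
    ∃ γ' : SL(2, ℤ), γ' 0 0 = γ 0 0 ∧ γ' 0 1 = ℓ * γ 0 1 ∧ γ 1 0 = ℓ * γ' 1 0 ∧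
      γ' 1 1 = γ 1 1 := by
  obtain ⟨c, hc⟩ := h
  refine ⟨⟨!![γ 0 0, ℓ * γ 0 1; c, γ 1 1], ?_⟩, by simp, by simp, by simpa using hc, by simp⟩
  have hd := γ.det_coe
  rw [Matrix.det_fin_two, hc] at hd
  rw [Matrix.det_fin_two_of]
  linear_combination hd

lemma dilate_smul {ℓ : ℕ} (hℓ : 0 < ℓ) {γ γ' : SL(2, ℤ)} (h00 : γ' 0 0 = γ 0 0)
    (h01 : γ' 0 1 = ℓ * γ 0 1) (h10 : γ 1 0 = ℓ * γ' 1 0) (h11 : γ' 1 1 = γ 1 1) (τ : ℍ) :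
    dilate ℓ hℓ (γ • τ) = γ' • dilate ℓ hℓ τ := by
  ext
  rw [coe_specialLinearGroup_apply]
  simp only [dilate, coe_specialLinearGroup_apply, h00, h01, h10, h11]
  push_cast
  rw [mul_div_assoc']
  congr 1 <;> simp <;> ring

lemma denom_dilate {ℓ : ℕ} (hℓ : 0 < ℓ) {γ γ' : SL(2, ℤ)} (h10 : γ 1 0 = ℓ * γ' 1 0)
    (h11 : γ' 1 1 = γ 1 1) (τ : ℍ) : denom γ' (dilate ℓ hℓ τ) = denom γ τ := by
  rw [ModularGroup.denom_apply, ModularGroup.denom_apply, h10, h11, dilate]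
  push_cast
  ring

/-- `h_ℓ` transforms like a modular form of weight `ℓ - 1` for `Γ₀(ℓ)`. -/
theorem hEll_smul {ℓ : ℕ} (hℓ : ℓ.Prime) (hℓ3 : 3 < ℓ) (γ : SL(2, ℤ)) (h : (ℓ : ℤ) ∣ γ 1 0)
    (τ : ℍ) : hEll ℓ (γ • τ) = denom γ τ ^ (ℓ - 1) * hEll ℓ τ := by
  obtain ⟨m, hm⟩ := hℓ.odd_of_ne_two (by lia)
  obtain ⟨γ', h00, h01, h10, h11⟩ := exists_conj_dilate γ h
  have h12 := twelve_dvd_of_prime hℓ hℓ3 hm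
  have hz : (m : ZMod 12) * (ℓ + 1) = 0 := by
    exact_mod_cast (ZMod.natCast_eq_zero_iff _ 12).mpr h12
  have hu : (ℓ : ZMod 12) ^ 2 = 1 := by
    rw [hm] at hz ⊢
    push_cast at hz ⊢
    linear_combination 2 * hz
  have hphase : slPhase γ' = ℓ * slPhase γ := by
    have hdet := det_cast_eq_one (ZMod 12) γ
    simp only [slPhase, h00, h01, h11, h10] at hdet ⊢
    push_cast at hdet ⊢
    exact etaSqPhase_conj hu hdet
  -- The phases at `τ` and `ℓτ` add up to `(1 + ℓ)` times that of `γ`, which the exponent `m` kills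
  -- modulo `12`.
  have hchar : ((ZMod.stdAddChar (slPhase γ) : ℂ) * ZMod.stdAddChar (slPhase γ')) ^ m = 1 := by
    rw [← AddChar.map_add_eq_mul, ← AddChar.map_nsmul_eq_pow, hphase, nsmul_eq_mul,
      show (m : ZMod 12) * (slPhase γ + ℓ * slPhase γ) = 0 by
        linear_combination slPhase γ * hz, AddChar.map_zero_eq_one]
  rw [hEll_eq_etaSq_pow hm hℓ.pos, hEll_eq_etaSq_pow hm hℓ.pos,
    dilate_smul hℓ.pos h00 h01 h10 h11, etaSq_smul, etaSq_smul, denom_dilate hℓ.pos h10 h11,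
    show ℓ - 1 = 2 * m by lia, pow_mul, ← mul_pow]
  calc _ = ((ZMod.stdAddChar (slPhase γ) : ℂ) * ZMod.stdAddChar (slPhase γ')) ^ m *
        (denom γ τ ^ 2 * (etaSq τ * etaSq (dilate ℓ hℓ.pos τ))) ^ m := by
        rw [← mul_pow]; ring
    _ = _ := by rw [hchar, one_mul]

/-- The point `τ / m` of the upper half plane, for a positive integer `m`. -/
noncomputable def shrink (m : ℕ) (hm : 0 < m) (τ : ℍ) : ℍ :=
  ⟨(τ : ℂ) / (m : ℂ), by
    have h : (0 : ℝ) < m := Nat.cast_pos.mpr hm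
    rw [Complex.div_natCast_im]
    exact div_pos τ.im_pos h⟩

lemma dilate_shrink {m : ℕ} (hm : 0 < m) (τ : ℍ) : dilate m hm (shrink m hm τ) = τ := by
  ext
  have : (m : ℂ) ≠ 0 := by exact_mod_cast hm.ne'
  simp [dilate, shrink, mul_div_cancel₀ _ this]

lemma dilate_S_smul {m : ℕ} (hm : 0 < m) (τ : ℍ) :
    dilate m hm (ModularGroup.S • τ) = ModularGroup.S • shrink m hm τ := by
  ext
  rw [modular_S_smul, modular_S_smul]
  simp [dilate, shrink, div_eq_mul_inv]

/-- The behaviour of `h_ℓ` under the inversion `τ ↦ -1 / τ`. -/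
lemma hEll_S_smul {ℓ m : ℕ} (hm : ℓ = 2 * m + 1) (hℓ : 0 < ℓ) (τ : ℍ) :
    hEll ℓ (ModularGroup.S • τ) =
      (-1) ^ m * ((ℓ : ℂ) ^ m)⁻¹ * (τ : ℂ) ^ (ℓ - 1) * hEll ℓ (shrink ℓ hℓ τ) := by
  rw [hEll_eq_etaSq_pow hm hℓ, hEll_eq_etaSq_pow hm hℓ, dilate_shrink, dilate_S_smul, etaSq_S_smul,
    etaSq_S_smul, show ℓ - 1 = 2 * m by lia, pow_mul, ← inv_pow, ← mul_pow, ← mul_pow, ← mul_pow]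
  congr 1
  have : ((shrink ℓ hℓ τ : ℍ) : ℂ) = τ / ℓ := rfl
  rw [this]
  linear_combination (τ : ℂ) * (τ / ℓ) * etaSq τ * etaSq (shrink ℓ hℓ τ) * Complex.I_sq

/-! ### The trace from `Γ₀(ℓ)` to level one -/

section Trace

variable {ℓ : ℕ} {K : ℤ} {f : ℍ → ℂ}

/-- The divisibility says `γ₁ γ₂⁻¹ ∈ Γ₀(ℓ)`: cosets correspond to bottom rows as points of the
projective line over `𝔽_ℓ`. -/
lemma slash_eq_of_dvd (hf : ∀ γ : SL(2, ℤ), (ℓ : ℤ) ∣ γ 1 0 → f ∣[K] γ = f) {γ₁ γ₂ : SL(2, ℤ)}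
    (h : (ℓ : ℤ) ∣ γ₁ 1 0 * γ₂ 1 1 - γ₁ 1 1 * γ₂ 1 0) : f ∣[K] γ₁ = f ∣[K] γ₂ := by
  have h' : f ∣[K] (γ₁ * γ₂⁻¹) = f := hf _ <| by
    simpa [Matrix.SpecialLinearGroup.coe_mul, Matrix.SpecialLinearGroup.coe_inv,
      Matrix.adjugate_fin_two, Matrix.mul_apply, Fin.sum_univ_two, sub_eq_add_neg] using h
  conv_rhs => rw [← h', ← SlashAction.slash_mul]
  simp

lemma S_mul_T_zpow_one_zero (n : ℤ) : (ModularGroup.S * ModularGroup.T ^ n) 1 0 = 1 := by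
  simp [Matrix.SpecialLinearGroup.coe_mul, ModularGroup.coe_S, ModularGroup.coe_T_zpow]

lemma S_mul_T_zpow_one_one (n : ℤ) : (ModularGroup.S * ModularGroup.T ^ n) 1 1 = n := by
  simp [Matrix.SpecialLinearGroup.coe_mul, ModularGroup.coe_S, ModularGroup.coe_T_zpow]

lemma mul_S_one_zero (γ : SL(2, ℤ)) : (γ * ModularGroup.S) 1 0 = γ 1 1 := by
  simp [Matrix.SpecialLinearGroup.coe_mul, ModularGroup.coe_S, Matrix.mul_apply]

lemma mul_S_one_one (γ : SL(2, ℤ)) : (γ * ModularGroup.S) 1 1 = -γ 1 0 := by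
  simp [Matrix.SpecialLinearGroup.coe_mul, ModularGroup.coe_S, Matrix.mul_apply]

lemma slash_S_mul_T_zpow_congr (hf : ∀ γ : SL(2, ℤ), (ℓ : ℤ) ∣ γ 1 0 → f ∣[K] γ = f) {n n' : ℤ}
    (h : (n : ZMod ℓ) = n') :
    f ∣[K] (ModularGroup.S * ModularGroup.T ^ n) = f ∣[K] (ModularGroup.S * ModularGroup.T ^ n') :=
  slash_eq_of_dvd hf <| by
    simp only [S_mul_T_zpow_one_zero, S_mul_T_zpow_one_one, one_mul, mul_one]
    exact (ZMod.intCast_eq_intCast_iff_dvd_sub _ _ _).mp h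

variable (ℓ K f) in
/-- The sum of the translates of `f` by the representatives `1` and `S T ^ j`, `0 ≤ j < ℓ`, of
`Γ₀(ℓ) \ SL(2, ℤ)`, for `ℓ` prime. -/
noncomputable def traceFromPrime [NeZero ℓ] : ℍ → ℂ :=
  f + ∑ j : ZMod ℓ, f ∣[K] (ModularGroup.S * ModularGroup.T ^ (j.val : ℤ))

lemma traceFromPrime_slash_T [NeZero ℓ] (hf : ∀ γ : SL(2, ℤ), (ℓ : ℤ) ∣ γ 1 0 → f ∣[K] γ = f) :
    traceFromPrime ℓ K f ∣[K] ModularGroup.T = traceFromPrime ℓ K f := by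
  have hT : f ∣[K] ModularGroup.T = f := hf _ (by simp [ModularGroup.coe_T])
  rw [traceFromPrime, SlashAction.add_slash, SlashAction.sum_slash, hT]
  congr 1
  refine (Finset.sum_congr rfl fun j _ ↦ ?_).trans (Equiv.sum_comp (Equiv.addRight (1 : ZMod ℓ))
    fun j ↦ f ∣[K] (ModularGroup.S * ModularGroup.T ^ (j.val : ℤ)))
  rw [← SlashAction.slash_mul, mul_assoc, ← zpow_add_one]
  exact slash_S_mul_T_zpow_congr hf (by simp)

/-- Right multiplication by `S` swaps the cosets of `1` and `S`, and sends that of `S T ^ j` to that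
of `S T ^ (-1/j)` for `j ≠ 0`. -/
lemma traceFromPrime_slash_S [Fact ℓ.Prime]
    (hf : ∀ γ : SL(2, ℤ), (ℓ : ℤ) ∣ γ 1 0 → f ∣[K] γ = f) :
    traceFromPrime ℓ K f ∣[K] ModularGroup.S = traceFromPrime ℓ K f := by
  set t : ZMod ℓ → ℍ → ℂ := fun j ↦ f ∣[K] (ModularGroup.S * ModularGroup.T ^ (j.val : ℤ))
  have hS : f ∣[K] ModularGroup.S = t 0 := by simp [t]
  have hSS : t 0 ∣[K] ModularGroup.S = f := by
    rw [← hS, ← SlashAction.slash_mul]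
    exact hf _ (by rw [mul_S_one_zero]; simp [ModularGroup.coe_S])
  have ht : ∀ j ≠ 0, t j ∣[K] ModularGroup.S = t (-j⁻¹) := fun j hj ↦ by
    rw [← SlashAction.slash_mul]
    refine slash_eq_of_dvd hf ?_
    rw [mul_S_one_zero, mul_S_one_one, S_mul_T_zpow_one_zero, S_mul_T_zpow_one_zero,
      S_mul_T_zpow_one_one, S_mul_T_zpow_one_one, ← ZMod.intCast_zmod_eq_zero_iff_dvd]
    simp [mul_inv_cancel₀ hj]
  -- Since `0⁻¹ = 0` in `ZMod ℓ`, this involution fixes `0`, whose term is then split off.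
  have hinv : Function.Involutive fun j : ZMod ℓ ↦ -j⁻¹ := fun j ↦ by simp [inv_neg]
  have hsum : ∑ j, t j = ∑ j, t (-j⁻¹) := (Equiv.sum_comp hinv.toPerm t).symm
  rw [← Finset.add_sum_erase _ _ (Finset.mem_univ 0),
    ← Finset.add_sum_erase _ (fun j ↦ t (-j⁻¹)) (Finset.mem_univ 0)] at hsum
  rw [traceFromPrime, SlashAction.add_slash, SlashAction.sum_slash]
  change f ∣[K] ModularGroup.S + ∑ j, t j ∣[K] ModularGroup.S = f + ∑ j, t j
  rw [← Finset.add_sum_erase _ _ (Finset.mem_univ 0),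
    ← Finset.add_sum_erase _ t (Finset.mem_univ 0),
    Finset.sum_congr rfl fun j hj ↦ ht j (Finset.ne_of_mem_erase hj), hS, hSS, hsum]
  simp only [inv_zero, neg_zero]
  abel

end Trace

/-! ### Holomorphy and behaviour at `i∞` -/

lemma tendsto_dilate_atImInfty {m : ℕ} (hm : 0 < m) :
    Tendsto (dilate m hm) atImInfty atImInfty := by
  refine tendsto_comap_iff.mpr ?_
  have : (UpperHalfPlane.im ∘ dilate m hm) = fun τ ↦ (m : ℝ) * τ.im := by
    ext τ
    rw [Function.comp_apply, ← coe_im]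
    simp [dilate]
  rw [this]
  exact tendsto_comap.const_mul_atTop (Nat.cast_pos.mpr hm)

lemma tendsto_shrink_atImInfty {m : ℕ} (hm : 0 < m) :
    Tendsto (shrink m hm) atImInfty atImInfty := by
  refine tendsto_comap_iff.mpr ?_
  have : (UpperHalfPlane.im ∘ shrink m hm) = fun τ ↦ τ.im / (m : ℝ) := by
    ext τ
    rw [Function.comp_apply, ← coe_im]
    simp [shrink, Complex.div_natCast_im]
  rw [this]
  exact tendsto_comap.atTop_div_const (Nat.cast_pos.mpr hm)

lemma tendsto_vadd_atImInfty (x : ℝ) :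
    Tendsto (fun τ : ℍ ↦ x +ᵥ τ) atImInfty atImInfty := by
  refine tendsto_comap_iff.mpr ?_
  have : (UpperHalfPlane.im ∘ fun τ : ℍ ↦ x +ᵥ τ) = UpperHalfPlane.im := by
    ext τ
    simp
  rw [this]
  exact tendsto_comap

lemma mdifferentiable_comp_dilate {f : ℍ → ℂ} (hf : MDiff f) {m : ℕ} (hm : 0 < m) :
    MDiff (fun τ ↦ f (dilate m hm τ)) := by
  rw [UpperHalfPlane.mdifferentiable_iff] at hf ⊢
  have hmap : Set.MapsTo (fun z : ℂ ↦ (m : ℂ) * z) {z | 0 < z.im} {z | 0 < z.im} := fun z hz ↦ by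
    simpa using mul_pos (Nat.cast_pos (α := ℝ).mpr hm) hz
  refine (hf.comp (by fun_prop) hmap).congr fun z hz ↦ ?_
  simp only [Function.comp_apply, ofComplex_apply_of_im_pos hz,
    ofComplex_apply_of_im_pos (hmap hz)]
  rfl

lemma mdifferentiable_eta : MDiff (fun τ : ℍ ↦ ModularForm.eta τ) := by
  rw [UpperHalfPlane.mdifferentiable_iff]
  refine .congr (fun z hz ↦
    (differentiableAt_eta_of_mem_upperHalfPlaneSet hz).differentiableWithinAt) fun z hz ↦ ?_
  simp [ofComplex_apply_of_im_pos hz]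

/-- Read off from the vanishing of the discriminant `η ^ 24`. -/
lemma tendsto_eta_atImInfty : Tendsto (fun τ : ℍ ↦ ModularForm.eta τ) atImInfty (𝓝 0) := by
  rw [Metric.tendsto_nhds]
  intro ε hε
  filter_upwards [Metric.tendsto_nhds.mp discriminant_isZeroAtImInfty (ε ^ 24) (by positivity)]
    with τ hτ
  rw [dist_zero_right] at hτ ⊢
  rw [discriminant, norm_pow] at hτ
  exact lt_of_pow_lt_pow_left₀ 24 hε.le hτ

lemma mdifferentiable_hEll {ℓ : ℕ} (hℓ : 0 < ℓ) : MDiff (hEll ℓ) :=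
  (mdifferentiable_eta.mul (mdifferentiable_comp_dilate mdifferentiable_eta hℓ)).pow (ℓ - 1)

lemma isZeroAtImInfty_hEll {ℓ : ℕ} (hℓ : 1 < ℓ) : IsZeroAtImInfty (hEll ℓ) := by
  have hpos : 0 < ℓ := by lia
  have h := (tendsto_eta_atImInfty.mul
    (tendsto_eta_atImInfty.comp (tendsto_dilate_atImInfty hpos))).pow (ℓ - 1)
  rwa [mul_zero, zero_pow (by lia)] at h

lemma UpperHalfPlane.IsZeroAtImInfty.mul_isBoundedAtImInfty {f g : ℍ → ℂ} (hf : IsZeroAtImInfty f)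
    (hg : IsBoundedAtImInfty g) : IsZeroAtImInfty (fun τ ↦ f τ * g τ) :=
  hf.zero_mul_isBoundedUnder_le (Asymptotics.isBigO_one_iff ℝ |>.mp hg)

/-! ### The form `h_ℓ(τ) F(ℓτ)` and its trace -/

lemma modularForm_smul {k : ℕ} (F : ModularForm 𝒮ℒ (k : ℤ)) (γ : SL(2, ℤ)) (τ : ℍ) :
    F (γ • τ) = denom γ τ ^ k * F τ := by
  have h := congrFun (SlashInvariantFormClass.slash_action_eq F _ ⟨γ, rfl⟩) τ
  change ((F : ℍ → ℂ) ∣[(k : ℤ)] γ) τ = F τ at h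
  rw [SL_slash_apply, zpow_neg, zpow_natCast] at h
  rw [← h, mul_comm, inv_mul_cancel_right₀ (pow_ne_zero _ (denom_ne_zero _ τ))]

/-- The function `τ ↦ h_ℓ(τ) F(ℓτ)`. -/
noncomputable def hEllMulDilate {ℓ : ℕ} (hℓ : ℓ.Prime) {k : ℕ}
    (F : ModularForm 𝒮ℒ (k : ℤ)) : ℍ → ℂ :=
  fun τ ↦ hEll ℓ τ * F (dilate ℓ hℓ.pos τ)

lemma hEllMulDilate_slash {ℓ : ℕ} (hℓ : ℓ.Prime) (hℓ3 : 3 < ℓ) {k : ℕ} (F : ModularForm 𝒮ℒ (k : ℤ))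
    (γ : SL(2, ℤ)) (h : (ℓ : ℤ) ∣ γ 1 0) :
    hEllMulDilate hℓ F ∣[(k : ℤ) + ℓ - 1] γ = hEllMulDilate hℓ F := by
  ext τ
  obtain ⟨γ', h00, h01, h10, h11⟩ := exists_conj_dilate γ h
  simp only [SL_slash_apply, hEllMulDilate]
  rw [dilate_smul hℓ.pos h00 h01 h10 h11, modularForm_smul,
    denom_dilate hℓ.pos h10 h11, hEll_smul hℓ hℓ3 γ h,
    show (k : ℤ) + ℓ - 1 = ((ℓ - 1 + k : ℕ) : ℤ) by lia, zpow_neg, zpow_natCast, pow_add]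
  have := denom_ne_zero γ τ
  field_simp

/-- Inversion turns `ℓτ` into `τ / ℓ`; the factor `ℓ^(-m)` comes from `h_ℓ` and `ℓ^(-k)` from the
weight of `F`. -/
lemma hEllMulDilate_slash_S {ℓ : ℕ} (hℓ : ℓ.Prime) {k : ℕ} (F : ModularForm 𝒮ℒ (k : ℤ))
    {m : ℕ} (hm : ℓ = 2 * m + 1) (τ : ℍ) :
    (hEllMulDilate hℓ F ∣[(k : ℤ) + ℓ - 1] ModularGroup.S) τ =
      (-1) ^ m * ((ℓ : ℂ) ^ (m + k))⁻¹ *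
        (hEll ℓ (shrink ℓ hℓ.pos τ) * F (shrink ℓ hℓ.pos τ)) := by
  rw [SL_slash_apply, hEllMulDilate, dilate_S_smul, modularForm_smul, hEll_S_smul hm hℓ.pos,
    ModularGroup.denom_S, ModularGroup.denom_S,
    show (k : ℤ) + ℓ - 1 = ((ℓ - 1 + k : ℕ) : ℤ) by lia, zpow_neg, zpow_natCast, pow_add,
    show ((shrink ℓ hℓ.pos τ : ℍ) : ℂ) = τ / ℓ from rfl, div_pow, pow_add]
  have := τ.ne_zero
  have : (ℓ : ℂ) ≠ 0 := by exact_mod_cast hℓ.ne_zero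
  field_simp

lemma hEllMulDilate_slash_S_mul_T_zpow {ℓ : ℕ} (hℓ : ℓ.Prime) {k : ℕ} (F : ModularForm 𝒮ℒ (k : ℤ))
    {m : ℕ} (hm : ℓ = 2 * m + 1) (n : ℤ) (τ : ℍ) :
    (hEllMulDilate hℓ F ∣[(k : ℤ) + ℓ - 1] (ModularGroup.S * ModularGroup.T ^ n)) τ =
      (-1) ^ m * ((ℓ : ℂ) ^ (m + k))⁻¹ *
        (hEll ℓ (shrink ℓ hℓ.pos ((n : ℝ) +ᵥ τ)) * F (shrink ℓ hℓ.pos ((n : ℝ) +ᵥ τ))) := by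
  have hd : denom (ModularGroup.T ^ n : SL(2, ℤ)) τ = 1 := by
    rw [ModularGroup.denom_apply]
    simp [ModularGroup.coe_T_zpow]
  rw [SlashAction.slash_mul, SL_slash_apply, hd, one_zpow, mul_one, modular_T_zpow_smul,
    hEllMulDilate_slash_S hℓ F hm]

lemma mdifferentiable_hEllMulDilate {ℓ : ℕ} (hℓ : ℓ.Prime) {k : ℕ} (F : ModularForm 𝒮ℒ (k : ℤ)) :
    MDiff (hEllMulDilate hℓ F) :=
  (mdifferentiable_hEll hℓ.pos).mul
    (mdifferentiable_comp_dilate (ModularFormClass.holo F) hℓ.pos)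

lemma isZeroAtImInfty_hEll_mul {ℓ : ℕ} (hℓ : ℓ.Prime) {k : ℕ} (F : ModularForm 𝒮ℒ (k : ℤ)) :
    IsZeroAtImInfty (fun τ ↦ hEll ℓ τ * F τ) :=
  (isZeroAtImInfty_hEll hℓ.one_lt).mul_isBoundedAtImInfty (ModularFormClass.bdd_at_infty F)

lemma isZeroAtImInfty_hEllMulDilate {ℓ : ℕ} (hℓ : ℓ.Prime) {k : ℕ} (F : ModularForm 𝒮ℒ (k : ℤ)) :
    IsZeroAtImInfty (hEllMulDilate hℓ F) :=
  (isZeroAtImInfty_hEll hℓ.one_lt).mul_isBoundedAtImInfty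
    ((ModularFormClass.bdd_at_infty F).comp_tendsto (tendsto_dilate_atImInfty hℓ.pos))

/-- The trace to level one of `h_ℓ(τ) F(ℓτ)`, as a cusp form. -/
lemma exists_cuspForm_eq_traceFromPrime {ℓ : ℕ} (hℓ : ℓ.Prime) (hℓ3 : 3 < ℓ) {k : ℕ}
    (F : ModularForm 𝒮ℒ (k : ℤ)) [Fact ℓ.Prime] :
    ∃ G : CuspForm 𝒮ℒ ((k : ℤ) + ℓ - 1),
      (G : ℍ → ℂ) = traceFromPrime ℓ ((k : ℤ) + ℓ - 1) (hEllMulDilate hℓ F) := by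
  obtain ⟨m, hm⟩ := hℓ.odd_of_ne_two (by lia)
  have hf := hEllMulDilate_slash hℓ hℓ3 F
  have hP := SlashInvariantForm.slash_action_generators_SL2Z (traceFromPrime_slash_S hf)
    (traceFromPrime_slash_T hf)
  refine ⟨⟨⟨traceFromPrime ℓ _ (hEllMulDilate hℓ F), ?_⟩, ?_, ?_⟩, rfl⟩
  · rintro _ ⟨γ, rfl⟩
    exact hP γ
  · exact (mdifferentiable_hEllMulDilate hℓ F).add <| .sum fun j _ ↦
      (mdifferentiable_hEllMulDilate hℓ F).slash _ _
  · intro c hc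
    rw [OnePoint.isZeroAt_iff_forall_SL2Z hc]
    intro γ _
    change IsZeroAtImInfty (traceFromPrime ℓ _ (hEllMulDilate hℓ F) ∣[_] γ)
    -- Level-one invariance reduces every cusp to `i∞`, where each translate vanishes.
    rw [hP γ, traceFromPrime]
    have hj : ∀ j : ZMod ℓ, Tendsto (hEllMulDilate hℓ F ∣[(k : ℤ) + ℓ - 1]
        (ModularGroup.S * ModularGroup.T ^ (j.val : ℤ))) atImInfty (𝓝 0) := fun j ↦ by
      rw [funext (hEllMulDilate_slash_S_mul_T_zpow hℓ F hm j.val),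
        ← mul_zero ((-1) ^ m * ((ℓ : ℂ) ^ (m + k))⁻¹)]
      exact (((isZeroAtImInfty_hEll_mul hℓ F).comp (tendsto_shrink_atImInfty hℓ.pos)).comp
        (tendsto_vadd_atImInfty _)).const_mul _
    have h0 := tendsto_finsetSum Finset.univ fun (j : ZMod ℓ) _ ↦ hj j
    rw [Finset.sum_const_zero, ← Finset.sum_fn] at h0
    exact (isZeroAtImInfty_hEllMulDilate hℓ F).add h0

/-! ### `q`-expansions and `U(ℓ)` -/

/-- `h_ℓ F` is represented by its `q`-expansion. -/
lemma hasQExpansion_hEll_mul {ℓ : ℕ} (hℓ : ℓ.Prime) (hℓ3 : 3 < ℓ) {k : ℕ}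
    (F : ModularForm 𝒮ℒ (k : ℤ)) :
    HasQExpansion (fun τ ↦ hEll ℓ τ * F τ) (qExpansion 1 (fun τ ↦ hEll ℓ τ * F τ)) := by
  intro τ
  have hper : Function.Periodic ((fun τ ↦ hEll ℓ τ * F τ) ∘ ofComplex) (1 : ℝ) := by
    intro w
    by_cases! hw : 0 < w.im
    · have hw' : 0 < (w + (1 : ℝ)).im := by simpa using hw
      have hT : ModularGroup.T • (⟨w, hw⟩ : ℍ) = ⟨w + (1 : ℝ), hw'⟩ := by
        rw [modular_T_smul]
        ext
        simp [add_comm]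
      have hd : denom ModularGroup.T (⟨w, hw⟩ : ℍ) = 1 := by
        rw [ModularGroup.denom_apply]
        simp [ModularGroup.coe_T]
      have h1 := hEll_smul hℓ hℓ3 ModularGroup.T (by simp [ModularGroup.coe_T]) ⟨w, hw⟩
      have h2 := modularForm_smul F ModularGroup.T ⟨w, hw⟩
      rw [hd, hT, one_pow, one_mul] at h1 h2
      simp only [Function.comp_apply, ofComplex_apply_of_im_pos hw', ofComplex_apply_of_im_pos hw,
        h1, h2]
    -- Off the upper half plane `ofComplex` takes a constant default value.
    · have hw' : (w + (1 : ℝ)).im ≤ 0 := by simpa using hw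
      simp only [Function.comp_apply, ofComplex_apply_of_im_nonpos hw',
        ofComplex_apply_of_im_nonpos hw]
  simpa only [smul_eq_mul] using
    UpperHalfPlane.hasSum_qExpansion one_pos hper
    ((mdifferentiable_hEll hℓ.pos).mul (ModularFormClass.holo F))
    (isZeroAtImInfty_hEll_mul hℓ F).isBoundedAtImInfty τ

/-- `U(ℓ)` averages a function over the translates of `τ / ℓ`. -/
lemma HasQExpansion.powerSeriesU {g : ℍ → ℂ} {p : PowerSeries ℂ} (hg : HasQExpansion g p) {ℓ : ℕ}
    [NeZero ℓ] (hℓ : 0 < ℓ) :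
    HasQExpansion (fun τ ↦ (ℓ : ℂ)⁻¹ * ∑ j : ZMod ℓ, g (shrink ℓ hℓ (((j.val : ℤ) : ℝ) +ᵥ τ)))
      (powerSeriesU ℓ p) := by
  intro τ
  have hℓ0 : (ℓ : ℂ) ≠ 0 := by exact_mod_cast hℓ.ne'
  set r : ℂ := Function.Periodic.qParam 1 (shrink ℓ hℓ τ : ℂ)
  have hr : r ^ ℓ = Function.Periodic.qParam 1 (τ : ℂ) := by
    simp only [r, Function.Periodic.qParam, ← Complex.exp_nat_mul, shrink]
    congr 1
    field_simp
  have hq : ∀ j : ZMod ℓ, Function.Periodic.qParam 1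
      (shrink ℓ hℓ (((j.val : ℤ) : ℝ) +ᵥ τ) : ℂ) = ZMod.stdAddChar j * r := fun j ↦ by
    have hj := ZMod.stdAddChar_coe (N := ℓ) j.val
    rw [Int.cast_natCast, ZMod.natCast_zmod_val] at hj
    rw [hj]
    simp only [r, Function.Periodic.qParam, ← Complex.exp_add, shrink, coe_vadd]
    congr 1
    push_cast
    field_simp
  have hsum := (hasSum_sum (s := Finset.univ) fun (j : ZMod ℓ) (_ : j ∈ Finset.univ) ↦
    hg (shrink ℓ hℓ (((j.val : ℤ) : ℝ) +ᵥ τ))).mul_left (ℓ : ℂ)⁻¹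
  -- Orthogonality of additive characters: averaging over `j` keeps only the exponents divisible by
  -- `ℓ`.
  have hcoeff : ∀ n : ℕ, (ℓ : ℂ)⁻¹ * ∑ j : ZMod ℓ, p.coeff n *
      Function.Periodic.qParam 1 (shrink ℓ hℓ (((j.val : ℤ) : ℝ) +ᵥ τ) : ℂ) ^ n =
      if ℓ ∣ n then p.coeff n * r ^ n else 0 := fun n ↦ by
    have hchar : ∀ j : ZMod ℓ, (ZMod.stdAddChar j : ℂ) ^ n = ZMod.stdAddChar (j * (n : ZMod ℓ)) :=
      fun j ↦ by rw [← AddChar.map_nsmul_eq_pow, nsmul_eq_mul, mul_comm]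
    simp_rw [hq, mul_pow, hchar, mul_left_comm (p.coeff n), ← Finset.sum_mul]
    rw [AddChar.sum_mulShift _ (ZMod.isPrimitive_stdAddChar ℓ), ZMod.card]
    simp only [ZMod.natCast_eq_zero_iff]
    split_ifs
    · rw [inv_mul_cancel_left₀ hℓ0]
    · simp
  simp_rw [hcoeff] at hsum
  rw [← (mul_right_injective₀ hℓ.ne').hasSum_iff] at hsum
  · refine hsum.congr_fun fun n ↦ ?_
    simp [_root_.powerSeriesU, pow_mul, hr]
  · intro n hn
    rw [if_neg]
    rintro ⟨c, rfl⟩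
    exact hn ⟨c, rfl⟩

theorem proposition3p3 (ℓ : ℕ) (hℓ : ℓ.Prime) (hℓ3 : 3 < ℓ) (k : ℕ) (hk : Even k)
    (F : ModularForm 𝒮ℒ (k : ℤ)) :
    -- the product `h_ℓ F` has a convergent `q`-expansion in nonnegative powers of `q`,
    HasQExpansion (fun τ ↦ hEll ℓ τ * F τ) (qExpansion 1 (fun τ ↦ hEll ℓ τ * F τ)) ∧
    -- applying `U(ℓ)` to it gives the `q`-expansion of a function `gU` on the upper half plane,
    ∃ gU : ℍ → ℂ,
      HasQExpansion gU (powerSeriesU ℓ (qExpansion 1 (fun τ ↦ hEll ℓ τ * F τ))) ∧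
      -- and the stated combination is a cusp form of level one and weight `k + ℓ - 1`.
      ∃ G : CuspForm 𝒮ℒ ((k : ℤ) + (ℓ : ℤ) - 1), ∀ τ : ℍ,
        G τ = gU τ + (-1 : ℂ) ^ ((ℓ - 1) / 2) * (ℓ : ℂ) ^ (k + (ℓ - 1) / 2 - 1) *
          hEll ℓ τ * F (dilate ℓ hℓ.pos τ) := by
  have : Fact ℓ.Prime := ⟨hℓ⟩
  obtain ⟨m, hm⟩ := hℓ.odd_of_ne_two (by lia)
  have hq := hasQExpansion_hEll_mul hℓ hℓ3 F
  obtain ⟨P, hP⟩ := exists_cuspForm_eq_traceFromPrime hℓ hℓ3 F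
  have hℓ0 : (ℓ : ℂ) ≠ 0 := by exact_mod_cast hℓ.ne_zero
  -- The scalar cancels the constant of `f ∣ S` up to the factor `1/ℓ` in `U(ℓ)`; as `m ≥ 1`, the
  -- exponent `k + m - 1` is not truncated.
  refine ⟨hq, _, hq.powerSeriesU hℓ.pos, ((-1 : ℂ) ^ m * (ℓ : ℂ) ^ (k + m - 1)) • P, fun τ ↦ ?_⟩
  have hsq : ((-1 : ℂ) ^ m) * (-1) ^ m = 1 := by rw [← mul_pow]; simp
  have hpow : (ℓ : ℂ) ^ (k + m - 1) * ((ℓ : ℂ) ^ (m + k))⁻¹ = (ℓ : ℂ)⁻¹ := by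
    rw [show m + k = k + m - 1 + 1 by lia, pow_succ]
    field_simp
  rw [show (ℓ - 1) / 2 = m by lia, smul_apply, hP, traceFromPrime, Pi.add_apply,
    Finset.sum_apply, smul_eq_mul]
  simp_rw [hEllMulDilate_slash_S_mul_T_zpow hℓ F hm]
  rw [← Finset.mul_sum, hEllMulDilate]
  set A := ∑ j : ZMod ℓ, hEll ℓ (shrink ℓ hℓ.pos (((j.val : ℤ) : ℝ) +ᵥ τ)) *
    F (shrink ℓ hℓ.pos (((j.val : ℤ) : ℝ) +ᵥ τ))
  linear_combination (ℓ : ℂ) ^ (k + m - 1) * ((ℓ : ℂ) ^ (m + k))⁻¹ * A * hsq + A * hpow
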